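/- Let $\mathbb{E}^N$ be Euclidean $N$-space. A smocking of $\mathbb{E}^N$ is a finite or countable collection $\{I_j : j\in J\}$ of pairwise disjoint, nonempty, connected, compact sets (stitches) with positive separation factor $\delta=\inf\{|z-z'| : z\in I_j,\ z'\in I_{j'},\ j\ne j'\}>0$. Let $S=\bigcup_j I_j$. The smocked space is $X=(\mathbb{E}^N\setminus S)\cup\{I_j : j\in J\}$, with smocking map $\pi:\mathbb{E}^N\to X$, $\pi(x)=x$ for $x\notin S$ and $\pi(x)=I_j$ for $x\in I_j$, and metric $$d(p,q)=\inf\Big\{|v-z_1|+\sum_{i=1}^{m-1}|z_i'-z_{i+1}|+|z_m'-w| \ :\ m\ge 0,\ \pi(v)=p,\ \pi(w)=q,\ z_i,z_i'\in I_{j_i},\ j_i\neq j_{i+1}\Big\},$$ where for $m=0$ the sum is read as $|v-w|$. Its smocking constants are the separation factor $\delta$, the depth $h=\inf\{r : \forall x\in\mathbb{E}^N\ \exists j\in J\ \exists z\in I_j,\ |x-z|<r\}$, and the lengths $L_{\min}=\inf_j \operatorname{diam} I_j$, $L_{\max}=\sup_j\operatorname{diam} I_j$. A sequence $(Y_n,y_n)$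 of complete noncompact pointed metric spaces converges in the pointed Gromov–Hausdorff sense to a complete noncompact pointed metric space $(Y,y)$ if for every $R>0$ the Gromov–Hausdorff distance between the closures $\overline{B}_R(y_n)$ and $\overline{B}_R(y)$ of the balls of radius $R$, with the restricted metrics, tends to $0$. **Proposition 3.5.** Let $X_k$, $k\in\mathbb{N}$, be smocked spaces obtained from smockings of the same $\mathbb{E}^N$, with smocking maps $\pi_k$ and smocking constants $L_{\max}^{(k)}$, $L_{\min}^{(k)}$, $h^{(k)}$, $\delta^{(k)}$. Suppose there are constants $L_{\max}<\infty$, $h<\infty$, $\delta>0$ and $L_{\min}>0$, independent of $k$, such that for all $k$ $$L_{\max}^{(k)}\le L_{\max},\qquad h^{(k)}\le h,\qquad \delta^{(k)}\ge\delta,\qquad L_{\min}^{(k)}\ge L_{\min}.$$ Then the family $\{(X_k,\pi_k(0))\}_{k}$ is precompact in the pointed Gromov–Hausdorff topology: every sequence of members of the family has a subsequence which converges in the pointed Gromov–Hausdorff sense to some complete noncompact pointed metric space. -/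

import Mathlib

open Set Filter Topology
open scoped ENNReal NNReal

/-! ### Gromov–Hausdorff distance and pointed Gromov–Hausdorff convergence -/

/-- The Gromov–Hausdorff distance of two metric spaces: the infimum of the Hausdorff distances of
`f(X)` and `g(Y)` over all metric spaces `Z` and isometric embeddings `f : X → Z`, `g : Y → Z`. -/
noncomputable def ghEDist (X Y : Type) [MetricSpace X] [MetricSpace Y] : ℝ≥0∞ :=
  ⨅ (Z : Type) (_ : MetricSpace Z) (f : X → Z) (g : Y → Z) (_ : Isometry f) (_ : Isometry g),
    Metric.hausdorffEDist (range f) (range g)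

/-- Pointed Gromov–Hausdorff convergence of a sequence of complete noncompact pointed metric spaces
to a complete noncompact pointed metric space: for every `R > 0`, the closures of the balls of
radius `R` about the base points converge in the Gromov–Hausdorff distance. -/
structure PGHConverges {X : ℕ → Type} [∀ j, MetricSpace (X j)] (x : ∀ j, X j)
    {Y : Type} [MetricSpace Y] (y : Y) : Prop where
  complete : ∀ j, CompleteSpace (X j)
  noncompact : ∀ j, NoncompactSpace (X j)
  complete_lim : CompleteSpace Y
  noncompact_lim : NoncompactSpace Y
  tendsto_ball : ∀ R : ℝ, 0 < R →
    Tendsto (fun j => ghEDist (closure (Metric.ball (x j) R)) (closure (Metric.ball y R)))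
      atTop (𝓝 0)

/-- A family of pointed metric spaces is precompact in the pointed Gromov–Hausdorff topology if
every sequence of members of the family has a subsequence which converges in the pointed
Gromov–Hausdorff sense (to some pointed metric space, not necessarily in the family). -/
def PGHPrecompact {ι : Type} {X : ι → Type} [∀ i, MetricSpace (X i)] (x : ∀ i, X i) : Prop :=
  ∀ s : ℕ → ι, ∃ φ : ℕ → ℕ, StrictMono φ ∧
    ∃ (Y : Type) (_ : MetricSpace Y) (y : Y), PGHConverges (fun j => x (s (φ j))) y

/-! ### Smocked spaces -/

/-- A collection of smocking stitches in Euclidean space `𝔼^N`: a finite or countable collection of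
disjoint connected compact (nonempty) sets, with a positive separation between distinct ones. -/
structure Smocking (N : ℕ) where
  J : Type
  countable : Countable J
  stitch : J → Set (EuclideanSpace ℝ (Fin N))
  isCompact : ∀ j, IsCompact (stitch j)
  isConnected : ∀ j, IsConnected (stitch j)
  disjoint : ∀ i j, i ≠ j → Disjoint (stitch i) (stitch j)
  separation_pos :
    0 < ⨅ (i : J) (j : J) (_ : i ≠ j) (z ∈ stitch i) (z' ∈ stitch j), edist z z'

namespace Smocking

variable {N : ℕ} (P : Smocking N)

/-- The smocking separation factor `δ` (which is `∞` if there is at most one stitch). -/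
noncomputable def separation : ℝ≥0∞ :=
  ⨅ (i : P.J) (j : P.J) (_ : i ≠ j) (z ∈ P.stitch i) (z' ∈ P.stitch j), edist z z'

/-- The smocking depth `h`: the infimum of all `r` such that every point lies at distance less
than `r` from some stitch (`∞` if there is no finite such `r`). -/
noncomputable def depth : ℝ≥0∞ :=
  sInf {r : ℝ≥0∞ | ∀ x : EuclideanSpace ℝ (Fin N), ∃ j, ∃ z ∈ P.stitch j, edist x z < r}

/-- The minimum smocking length `L_min`, the infimum of the diameters of the stitches. -/
noncomputable def lengthMin : ℝ≥0∞ := ⨅ j, Metric.ediam (P.stitch j)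

/-- The maximum smocking length `L_max`, the supremum of the diameters of the stitches. -/
noncomputable def lengthMax : ℝ≥0∞ := ⨆ j, Metric.ediam (P.stitch j)

/-- The smocking set `S`, the union of the stitches. -/
def smockingSet : Set (EuclideanSpace ℝ (Fin N)) := ⋃ j, P.stitch j

/-- The underlying set of the smocked space: the points outside the smocking set, together with one
point for each stitch. -/
inductive Space : Type
  | point (x : {x : EuclideanSpace ℝ (Fin N) // x ∉ P.smockingSet})
  | collapsed (j : P.J)

open Classical in
/-- The smocking map `π`: the identity off the smocking set, and constant on each stitch. -/
noncomputable def proj (x : EuclideanSpace ℝ (Fin N)) : P.Space :=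
  if h : x ∈ P.smockingSet then .collapsed (mem_iUnion.1 h).choose else .point ⟨x, h⟩

/-- The sum `|v - z₁| + ∑ |z'ᵢ - zᵢ₊₁| + |z'ₖ - w|` for a list of triples `(jᵢ, zᵢ, z'ᵢ)`; it
is `|v - w|` for the empty list. -/
noncomputable def pathLength (v : EuclideanSpace ℝ (Fin N)) :
    List (P.J × EuclideanSpace ℝ (Fin N) × EuclideanSpace ℝ (Fin N)) →
      EuclideanSpace ℝ (Fin N) → ℝ
  | [], w => dist v w
  | a :: l, w => dist v a.2.1 + pathLength a.2.2 l w

/-- The lengths of the chains of segments from `v` to `w` passing through `k` stitches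
`j₁ ≠ j₂ ≠ ⋯ ≠ jₖ`, entering the `i`-th at `zᵢ` and leaving it at `z'ᵢ`. The minimum of
this set (if it is not empty) is `d_k(v, w)`. -/
def chainLengths (k : ℕ) (v w : EuclideanSpace ℝ (Fin N)) : Set ℝ :=
  {ℓ | ∃ l : List (P.J × EuclideanSpace ℝ (Fin N) × EuclideanSpace ℝ (Fin N)),
    l.length = k ∧ (∀ a ∈ l, a.2.1 ∈ P.stitch a.1 ∧ a.2.2 ∈ P.stitch a.1) ∧
    l.IsChain (fun a b => a.1 ≠ b.1) ∧ ℓ = P.pathLength v l w}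

/-- All lengths of chains of segments, through any number of stitches, between points over `p` and
over `q`. -/
def connectingLengths (p q : P.Space) : Set ℝ :=
  {ℓ | ∃ v w, P.proj v = p ∧ P.proj w = q ∧ ∃ k, ℓ ∈ P.chainLengths k v w}

/-- The smocked distance, `min {d_k(v, w) : k ∈ ℕ, π(v) = p, π(w) = q}`. -/
noncomputable def smockedDist (p q : P.Space) : ℝ := sInf (P.connectingLengths p q)

/-! The smocked distance is a metric. -/

theorem proj_of_mem {x : EuclideanSpace ℝ (Fin N)} {j : P.J} (h : x ∈ P.stitch j) :
    P.proj x = Space.collapsed j := by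
  classical
  have hS : x ∈ P.smockingSet := mem_iUnion.2 ⟨j, h⟩
  rw [proj, dif_pos hS]
  congr 1
  by_contra hne
  exact Set.disjoint_left.1 (P.disjoint _ _ hne) (mem_iUnion.1 hS).choose_spec h

theorem proj_of_notMem {x : EuclideanSpace ℝ (Fin N)} (h : x ∉ P.smockingSet) :
    P.proj x = Space.point ⟨x, h⟩ := by
  classical
  rw [proj, dif_neg h]

theorem proj_eq_inl {x : EuclideanSpace ℝ (Fin N)}
    {y : {x : EuclideanSpace ℝ (Fin N) // x ∉ P.smockingSet}}
    (h : P.proj x = Space.point y) : x = y := by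
  by_cases hx : x ∈ P.smockingSet
  · obtain ⟨j, hj⟩ := mem_iUnion.1 hx
    rw [P.proj_of_mem hj] at h
    cases h
  · rw [P.proj_of_notMem hx] at h
    cases h
    rfl

theorem proj_eq_inr {x : EuclideanSpace ℝ (Fin N)} {j : P.J} (h : P.proj x = Space.collapsed j) :
    x ∈ P.stitch j := by
  by_cases hx : x ∈ P.smockingSet
  · obtain ⟨i, hi⟩ := mem_iUnion.1 hx
    rw [P.proj_of_mem hi] at h
    cases h
    exact hi
  · rw [P.proj_of_notMem hx] at h
    cases h

theorem proj_surjective : Function.Surjective P.proj := by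
  rintro (x | j)
  · exact ⟨x, P.proj_of_notMem x.2⟩
  · obtain ⟨z, hz⟩ := (P.isConnected j).nonempty
    exact ⟨z, P.proj_of_mem hz⟩

theorem exists_separation : ∃ δ : ℝ, 0 < δ ∧ ∀ i j, i ≠ j → ∀ z ∈ P.stitch i, ∀ z' ∈ P.stitch j,
    δ ≤ dist z z' := by
  obtain ⟨ε, hε, hlt⟩ := ENNReal.lt_iff_exists_nnreal_btwn.1 P.separation_pos
  refine ⟨ε, by exact_mod_cast hε, fun i j hij z hz z' hz' => ?_⟩
  have h : (ε : ℝ≥0∞) ≤ edist z z' :=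
    hlt.le.trans (iInf_le_of_le i <| iInf_le_of_le j <| iInf_le_of_le hij <| iInf_le_of_le z <|
      iInf_le_of_le hz <| iInf_le_of_le z' <| iInf_le _ hz')
  rw [edist_nndist] at h
  rw [← coe_nndist]
  exact_mod_cast h

theorem isClosed_smockingSet : IsClosed P.smockingSet := by
  obtain ⟨δ, hδ, hsep⟩ := P.exists_separation
  refine LocallyFinite.isClosed_iUnion (fun x => ⟨Metric.ball x (δ / 2),
    Metric.ball_mem_nhds x (half_pos hδ), ?_⟩) (fun j => (P.isCompact j).isClosed)
  refine Set.Subsingleton.finite ?_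
  rintro i ⟨z, hz, hzx⟩ j ⟨z', hz', hzx'⟩
  by_contra hij
  have h1 := hsep i j hij z hz z' hz'
  have h2 := dist_triangle_right z z' x
  rw [Metric.mem_ball] at hzx hzx'
  linarith

theorem pathLength_nonneg (v w : EuclideanSpace ℝ (Fin N))
    (l : List (P.J × EuclideanSpace ℝ (Fin N) × EuclideanSpace ℝ (Fin N))) :
    0 ≤ P.pathLength v l w := by
  induction l generalizing v with
  | nil => exact dist_nonneg
  | cons a l ih => exact add_nonneg dist_nonneg (ih _)

theorem pathLength_append (v w : EuclideanSpace ℝ (Fin N))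
    (l m : List (P.J × EuclideanSpace ℝ (Fin N) × EuclideanSpace ℝ (Fin N)))
    (a : P.J × EuclideanSpace ℝ (Fin N) × EuclideanSpace ℝ (Fin N)) :
    P.pathLength v (l ++ a :: m) w = P.pathLength v l a.2.1 + P.pathLength a.2.2 m w := by
  induction l generalizing v with
  | nil => rfl
  | cons b l ih =>
    simp only [List.cons_append, pathLength]
    rw [ih, add_assoc]

theorem pathLength_triangle (v v' w : EuclideanSpace ℝ (Fin N))
    (l : List (P.J × EuclideanSpace ℝ (Fin N) × EuclideanSpace ℝ (Fin N))) :
    P.pathLength v l w ≤ dist v v' + P.pathLength v' l w := by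
  cases l with
  | nil => exact dist_triangle _ _ _
  | cons a l =>
    simp only [pathLength]
    linarith [dist_triangle v v' a.2.1]

theorem pathLength_append_le (v w u : EuclideanSpace ℝ (Fin N))
    (l m : List (P.J × EuclideanSpace ℝ (Fin N) × EuclideanSpace ℝ (Fin N))) :
    P.pathLength v (l ++ m) u ≤ P.pathLength v l w + P.pathLength w m u := by
  induction l generalizing v with
  | nil => exact P.pathLength_triangle v w u m
  | cons b l ih =>
    simp only [List.cons_append, pathLength]
    linarith [ih b.2.2]

theorem pathLength_reverse (v w : EuclideanSpace ℝ (Fin N))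
    (l : List (P.J × EuclideanSpace ℝ (Fin N) × EuclideanSpace ℝ (Fin N))) :
    P.pathLength w (l.reverse.map fun a => (a.1, a.2.2, a.2.1)) v = P.pathLength v l w := by
  induction l generalizing v with
  | nil => exact dist_comm _ _
  | cons a l ih =>
    simp only [List.reverse_cons, List.map_append, List.map_cons, List.map_nil]
    rw [pathLength_append, ih]
    simp only [pathLength]
    rw [dist_comm, add_comm]

theorem exists_reduced (w : EuclideanSpace ℝ (Fin N))
    (l : List (P.J × EuclideanSpace ℝ (Fin N) × EuclideanSpace ℝ (Fin N)))
    (hl : ∀ a ∈ l, a.2.1 ∈ P.stitch a.1 ∧ a.2.2 ∈ P.stitch a.1) :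
    ∃ m : List (P.J × EuclideanSpace ℝ (Fin N) × EuclideanSpace ℝ (Fin N)),
      (∀ a ∈ m, a.2.1 ∈ P.stitch a.1 ∧ a.2.2 ∈ P.stitch a.1) ∧
      m.IsChain (fun a b => a.1 ≠ b.1) ∧ ∀ v, P.pathLength v m w ≤ P.pathLength v l w := by
  induction l with
  | nil => exact ⟨[], by simp, by simp, fun v => le_rfl⟩
  | cons a l ih =>
    obtain ⟨m, hm, hc, hle⟩ := ih fun b hb => hl b (List.mem_cons_of_mem _ hb)
    have ha := hl a List.mem_cons_self
    cases m with
    | nil =>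
      refine ⟨[a], by simpa using ha, by simp, fun v => ?_⟩
      simpa only [pathLength, add_le_add_iff_left] using hle a.2.2
    | cons b m =>
      by_cases hab : a.1 = b.1
      · refine ⟨(b.1, a.2.1, b.2.2) :: m, ?_, ?_, fun v => ?_⟩
        · intro c hc'
          rcases List.mem_cons.1 hc' with rfl | hc'
          · exact ⟨hab ▸ ha.1, (hm b List.mem_cons_self).2⟩
          · exact hm c (List.mem_cons_of_mem _ hc')
        · cases m with
          | nil => simp
          | cons d m =>
            rw [List.isChain_cons_cons] at hc ⊢
            exact hc
        · have h := hle a.2.2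
          simp only [pathLength] at h ⊢
          linarith [dist_nonneg (x := a.2.2) (y := b.2.1)]
      · refine ⟨a :: b :: m, ?_, List.isChain_cons_cons.2 ⟨hab, hc⟩, fun v => ?_⟩
        · intro c hc'
          rcases List.mem_cons.1 hc' with rfl | hc'
          · exact ha
          · exact hm c hc'
        · have h := hle a.2.2
          simp only [pathLength] at h ⊢
          linarith

theorem connectingLengths_nonneg {p q : P.Space} {ℓ : ℝ} (h : ℓ ∈ P.connectingLengths p q) :
    0 ≤ ℓ := by
  obtain ⟨v, w, -, -, k, l, -, -, -, rfl⟩ := h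
  exact P.pathLength_nonneg v w l

theorem bddBelow_connectingLengths (p q : P.Space) : BddBelow (P.connectingLengths p q) :=
  ⟨0, fun _ h => P.connectingLengths_nonneg h⟩

theorem dist_mem_connectingLengths (v w : EuclideanSpace ℝ (Fin N)) :
    dist v w ∈ P.connectingLengths (P.proj v) (P.proj w) :=
  ⟨v, w, rfl, rfl, 0, [], rfl, by simp, by simp, rfl⟩

theorem connectingLengths_nonempty (p q : P.Space) : (P.connectingLengths p q).Nonempty := by
  obtain ⟨v, rfl⟩ := P.proj_surjective p
  obtain ⟨w, rfl⟩ := P.proj_surjective q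
  exact ⟨_, P.dist_mem_connectingLengths v w⟩

theorem smockedDist_self (p : P.Space) : P.smockedDist p p = 0 := by
  obtain ⟨v, rfl⟩ := P.proj_surjective p
  refine le_antisymm ?_ (Real.sInf_nonneg fun _ h => P.connectingLengths_nonneg h)
  have h := P.dist_mem_connectingLengths v v
  rw [dist_self] at h
  exact csInf_le (P.bddBelow_connectingLengths _ _) h

theorem connectingLengths_symm {p q : P.Space} {ℓ : ℝ} (h : ℓ ∈ P.connectingLengths p q) :
    ℓ ∈ P.connectingLengths q p := by
  obtain ⟨v, w, hv, hw, k, l, hk, hl, hc, rfl⟩ := h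
  refine ⟨w, v, hw, hv, k, l.reverse.map fun a => (a.1, a.2.2, a.2.1), by simpa using hk, ?_, ?_,
    (P.pathLength_reverse v w l).symm⟩
  · intro a ha
    obtain ⟨b, hb, rfl⟩ := List.mem_map.1 ha
    exact (hl b (List.mem_reverse.1 hb)).symm
  · rw [List.isChain_map, List.isChain_reverse]
    exact hc.imp fun a b hab => hab.symm

theorem smockedDist_comm (p q : P.Space) : P.smockedDist p q = P.smockedDist q p := by
  unfold smockedDist
  congr 1
  ext ℓ
  exact ⟨P.connectingLengths_symm, P.connectingLengths_symm⟩

theorem exists_connecting_le_add {p q r : P.Space} {a b : ℝ} (ha : a ∈ P.connectingLengths p q)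
    (hb : b ∈ P.connectingLengths q r) : ∃ c ∈ P.connectingLengths p r, c ≤ a + b := by
  obtain ⟨v, w, hv, hw, -, l, -, hl, -, rfl⟩ := ha
  obtain ⟨w', u, hw', hu, -, m, -, hm, -, rfl⟩ := hb
  suffices h : ∃ n : List (P.J × EuclideanSpace ℝ (Fin N) × EuclideanSpace ℝ (Fin N)),
      (∀ a ∈ n, a.2.1 ∈ P.stitch a.1 ∧ a.2.2 ∈ P.stitch a.1) ∧
      P.pathLength v n u ≤ P.pathLength v l w + P.pathLength w' m u by
    obtain ⟨n, hn, hle⟩ := h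
    obtain ⟨n', hn', hc, hle'⟩ := P.exists_reduced u n hn
    exact ⟨_, ⟨v, u, hv, hu, _, n', rfl, hn', hc, rfl⟩, (hle' v).trans hle⟩
  rcases q with x | j
  · have h1 := P.proj_eq_inl hw
    have h2 := P.proj_eq_inl hw'
    refine ⟨l ++ m, ?_, ?_⟩
    · intro a ha
      rcases List.mem_append.1 ha with ha | ha
      · exact hl a ha
      · exact hm a ha
    · rw [h1, h2]
      exact P.pathLength_append_le v x u l m
  · have h1 := P.proj_eq_inr hw
    have h2 := P.proj_eq_inr hw'
    refine ⟨l ++ (j, w, w') :: m, ?_, (P.pathLength_append v u l m (j, w, w')).le⟩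
    intro a ha
    rcases List.mem_append.1 ha with ha | ha
    · exact hl a ha
    · rcases List.mem_cons.1 ha with rfl | ha
      · exact ⟨h1, h2⟩
      · exact hm a ha

theorem smockedDist_triangle (p q r : P.Space) :
    P.smockedDist p r ≤ P.smockedDist p q + P.smockedDist q r := by
  refine le_of_forall_pos_le_add fun ε hε => ?_
  obtain ⟨a, ha, ha'⟩ := exists_lt_of_csInf_lt (P.connectingLengths_nonempty p q)
    (lt_add_of_pos_right (P.smockedDist p q) (half_pos hε))
  obtain ⟨b, hb, hb'⟩ := exists_lt_of_csInf_lt (P.connectingLengths_nonempty q r)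
    (lt_add_of_pos_right (P.smockedDist q r) (half_pos hε))
  obtain ⟨c, hc, hle⟩ := P.exists_connecting_le_add ha hb
  have := csInf_le (P.bddBelow_connectingLengths p r) hc
  unfold smockedDist at *
  linarith

theorem le_pathLength_of_separation {δ : ℝ} (hδ : ∀ i j, i ≠ j → ∀ z ∈ P.stitch i,
      ∀ z' ∈ P.stitch j, δ ≤ dist z z') {i j : P.J} (hij : i ≠ j)
    {v w : EuclideanSpace ℝ (Fin N)} (hv : v ∈ P.stitch i) (hw : w ∈ P.stitch j)
    (l : List (P.J × EuclideanSpace ℝ (Fin N) × EuclideanSpace ℝ (Fin N)))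
    (hl : ∀ a ∈ l, a.2.1 ∈ P.stitch a.1 ∧ a.2.2 ∈ P.stitch a.1) :
    δ ≤ P.pathLength v l w := by
  induction l generalizing v with
  | nil => exact hδ i j hij v hv w hw
  | cons a l ih =>
    have ha := hl a List.mem_cons_self
    simp only [pathLength]
    by_cases hai : a.1 = i
    · have := ih (hai ▸ ha.2) fun b hb => hl b (List.mem_cons_of_mem _ hb)
      linarith [dist_nonneg (x := v) (y := a.2.1)]
    · have := hδ i a.1 (Ne.symm hai) v hv _ ha.1
      linarith [P.pathLength_nonneg a.2.2 w l]

theorem smockedDist_inl_pos (x : {x : EuclideanSpace ℝ (Fin N) // x ∉ P.smockingSet})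
    {q : P.Space} (hq : Space.point x ≠ q) : 0 < P.smockedDist (Space.point x) q := by
  -- the points over `q` together with the smocking set stay away from `x`
  obtain ⟨ε, hε, hS, hw⟩ : ∃ ε : ℝ, 0 < ε ∧ (∀ z ∈ P.smockingSet, ε ≤ dist x.1 z) ∧
      ∀ w, P.proj w = q → ε ≤ dist (x : EuclideanSpace ℝ (Fin N)) w := by
    obtain ⟨ε, hε, hball⟩ := Metric.isOpen_iff.1 P.isClosed_smockingSet.isOpen_compl x.1 x.2
    have hS : ∀ z ∈ P.smockingSet, ε ≤ dist x.1 z := fun z hz => by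
      by_contra! hlt
      exact hball (by rwa [Metric.mem_ball, dist_comm]) hz
    rcases q with y | j
    · have hxy : x.1 ≠ y.1 := fun h => hq (by rw [Subtype.ext h])
      refine ⟨min ε (dist x.1 y.1), lt_min hε (dist_pos.2 hxy),
        fun z hz => (min_le_left _ _).trans (hS z hz), fun w hw => ?_⟩
      rw [P.proj_eq_inl hw]
      exact min_le_right _ _
    · exact ⟨ε, hε, hS, fun w hw => hS w (mem_iUnion.2 ⟨j, P.proj_eq_inr hw⟩)⟩
  refine hε.trans_le (le_csInf (P.connectingLengths_nonempty _ _) ?_)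
  rintro ℓ ⟨v, w, hv, hwq, -, l, -, hl, -, rfl⟩
  rw [P.proj_eq_inl hv]
  cases l with
  | nil => exact hw w hwq
  | cons a l =>
    simp only [pathLength]
    have := hS a.2.1 (mem_iUnion.2 ⟨a.1, (hl a List.mem_cons_self).1⟩)
    linarith [P.pathLength_nonneg a.2.2 w l]

theorem eq_of_smockedDist_eq_zero {p q : P.Space} (h : P.smockedDist p q = 0) : p = q := by
  by_contra hpq
  rcases p with x | i
  · exact (P.smockedDist_inl_pos x hpq).ne' h
  · rcases q with y | j
    · rw [smockedDist_comm] at h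
      exact (P.smockedDist_inl_pos y (Ne.symm hpq)).ne' h
    · have hij : i ≠ j := fun e => hpq (by rw [e])
      obtain ⟨δ, hδ, hsep⟩ := P.exists_separation
      have : δ ≤ P.smockedDist (Space.collapsed i) (Space.collapsed j) := by
        refine le_csInf (P.connectingLengths_nonempty _ _) ?_
        rintro ℓ ⟨v, w, hv, hw, -, l, -, hl, -, rfl⟩
        exact P.le_pathLength_of_separation hsep hij (P.proj_eq_inr hv) (P.proj_eq_inr hw) l hl
      linarith

/-- The smocked space as a metric space, with the smocked distance. -/
noncomputable instance instMetricSpaceSpace : MetricSpace P.Space where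
  dist := P.smockedDist
  dist_self := P.smockedDist_self
  dist_comm := P.smockedDist_comm
  dist_triangle := P.smockedDist_triangle
  eq_of_dist_eq_zero := P.eq_of_smockedDist_eq_zero

end Smocking

/-!
A chain of length `ℓ` crosses at most `ℓ / δ + 1` stitches, each of diameter at most `L`, so a
smocking map, which is `1`-Lipschitz, contracts distances at most affinely, with constants that
depend only on `L` and `δ`. The distances pulled back to Euclidean space `E` are equi-Lipschitz on
`E × E`, so by Arzelà–Ascoli they subconverge locally uniformly to a pseudodistance, whose metric
quotient is the limit space; the affine control passes to the limit. Balls of radius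
`R` converge, and not just distances, because smocked spaces have approximate intermediate points: a
point slightly outside a ball is close to a point inside it.
-/

theorem ghEDist_le_of_biTotal {X Y : Type} [MetricSpace X] [MetricSpace Y] [Nonempty X]
    {r : X → Y → Prop} (hr : Relator.BiTotal r) {ε : ℝ} (hε : 0 < ε)
    (h : ∀ x y x' y', r x y → r x' y' → |dist x x' - dist y y'| ≤ 2 * ε) :
    ghEDist X Y ≤ ENNReal.ofReal ε := by
  let Φ : {p : X × Y // r p.1 p.2} → X := fun p => p.1.1
  let Ψ : {p : X × Y // r p.1 p.2} → Y := fun p => p.1.2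
  have : Nonempty {p : X × Y // r p.1 p.2} :=
    let ⟨y, hxy⟩ := hr.1 (Classical.arbitrary X)
    ⟨⟨(_, y), hxy⟩⟩
  let _ : MetricSpace (X ⊕ Y) :=
    Metric.glueMetricApprox Φ Ψ ε hε fun p q => h _ _ _ _ p.2 q.2
  have hglue : ∀ x y, r x y →
      edist (Sum.inl x : X ⊕ Y) (Sum.inr y) ≤ ENNReal.ofReal ε := fun x y hxy => by
    rw [edist_dist]
    exact ENNReal.ofReal_le_ofReal (Metric.glueDist_glued_points Φ Ψ ε ⟨(x, y), hxy⟩).le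
  refine iInf_le_of_le (X ⊕ Y) <| iInf_le_of_le inferInstance <| iInf_le_of_le Sum.inl <|
    iInf_le_of_le Sum.inr <| iInf_le_of_le (Isometry.of_dist_eq fun _ _ => rfl) <|
    iInf_le_of_le (Isometry.of_dist_eq fun _ _ => rfl) <|
    Metric.hausdorffEDist_le_of_mem_edist ?_ ?_
  · rintro _ ⟨x, rfl⟩
    obtain ⟨y, hxy⟩ := hr.1 x
    exact ⟨_, mem_range_self y, hglue x y hxy⟩
  · rintro _ ⟨y, rfl⟩
    obtain ⟨x, hxy⟩ := hr.2 y
    exact ⟨_, mem_range_self x, (edist_comm _ _).trans_le (hglue x y hxy)⟩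

theorem exists_subseq_tendstoLocallyUniformly_of_equicontinuous {F M : Type*} [TopologicalSpace F]
    [WeaklyLocallyCompactSpace F] [SigmaCompactSpace F] [MetricSpace M] {f : ℕ → F → M}
    (hf : Equicontinuous f) (hbdd : ∀ x, ∃ Q, IsCompact Q ∧ ∀ k, f k x ∈ Q) :
    ∃ φ : ℕ → ℕ, StrictMono φ ∧ ∃ g, TendstoLocallyUniformly (fun k => f (φ k)) g atTop := by
  choose Q hQ hfQ using hbdd
  let T : Set (F → M) := closure (range f)
  have hTequi : T.Equicontinuous := (equicontinuous_iff_range.1 hf).closure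
  have hTcompact : IsCompact T := (isCompact_univ_pi hQ).closure_of_subset
    (range_subset_iff.2 fun k x _ => hfQ x k)
  let S : Set C(F, M) := {g | ⇑g ∈ T}
  have himage : ContinuousMap.toFun '' S = T :=
    Subset.antisymm (image_subset_iff.2 fun _ hg => hg)
      fun g hg => ⟨⟨g, hTequi.continuous_of_mem hg⟩, hg, rfl⟩
  have hS : IsCompact S := ArzelaAscoli.isCompact_of_equicontinuous S (himage ▸ hTcompact)
    (hTequi.comp fun g : S => ⟨⇑g.1, g.2⟩)
  obtain ⟨g, -, φ, hφ, hg⟩ := hS.tendsto_subseq (x := fun k => ⟨f k, hf.continuous k⟩)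
    fun k => subset_closure (mem_range_self k)
  exact ⟨φ, hφ, g, ContinuousMap.tendsto_iff_tendstoLocallyUniformly.1 hg⟩

theorem exists_metricSpace_quotient.{u} {E : Type u} (d : E → E → ℝ)
    (hself : ∀ x, d x x = 0) (hcomm : ∀ x y, d x y = d y x)
    (htriangle : ∀ x y z, d x z ≤ d x y + d y z) :
    ∃ (Y : Type u) (_ : MetricSpace Y) (ρ : E → Y), Function.Surjective ρ ∧
      ∀ x y, dist (ρ x) (ρ y) = d x y :=
  let _ : PseudoMetricSpace E :=
    { dist := d, dist_self := hself, dist_comm := hcomm, dist_triangle := htriangle }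
  ⟨SeparationQuotient E, inferInstance, SeparationQuotient.mk,
    SeparationQuotient.surjective_mk, fun _ _ => rfl⟩

/-- The distances pulled back along `π` and `ρ` differ by at most `η` on `s`. It compares two
metric spaces parametrized by the same set. -/
def DistCloseOn {E X Y : Type*} [PseudoMetricSpace X] [PseudoMetricSpace Y] (η : ℝ) (s : Set E)
    (π : E → X) (ρ : E → Y) : Prop :=
  ∀ v ∈ s, ∀ w ∈ s, |dist (π v) (π w) - dist (ρ v) (ρ w)| ≤ η

theorem DistCloseOn.symm {E X Y : Type*} [PseudoMetricSpace X] [PseudoMetricSpace Y] {η : ℝ}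
    {s : Set E} {π : E → X} {ρ : E → Y} (h : DistCloseOn η s π ρ) : DistCloseOn η s ρ π :=
  fun v hv w hw => abs_sub_comm (dist (π v) (π w)) _ ▸ h v hv w hw

/-- Convergence of a sequence of metric spaces parametrized by the same space `E`: the distances
pulled back to `E` converge locally uniformly on `E × E`. -/
def DistConverges {E Y : Type*} [TopologicalSpace E] [PseudoMetricSpace Y] {X : ℕ → Type*}
    [∀ k, PseudoMetricSpace (X k)] (π : ∀ k, E → X k) (ρ : E → Y) : Prop :=
  TendstoLocallyUniformly (fun k (p : E × E) => dist (π k p.1) (π k p.2))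
    (fun p => dist (ρ p.1) (ρ p.2)) atTop

namespace DistConverges

variable {E Y : Type*} [PseudoMetricSpace Y] {X : ℕ → Type*} [∀ k, PseudoMetricSpace (X k)]
  {π : ∀ k, E → X k} {ρ : E → Y}

theorem tendsto_dist [TopologicalSpace E] (h : DistConverges π ρ) (v w : E) :
    Tendsto (fun k => dist (π k v) (π k w)) atTop (𝓝 (dist (ρ v) (ρ w))) :=
  (tendstoLocallyUniformlyOn_univ.2 h).tendsto_at (mem_univ (v, w))

theorem eventually_distCloseOn [PseudoMetricSpace E] [ProperSpace E] (h : DistConverges π ρ)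
    (o : E) (r : ℝ) {η : ℝ} (hη : 0 < η) :
    ∀ᶠ k in atTop, DistCloseOn η (Metric.closedBall o r) (π k) ρ := by
  have hcompact := (isCompact_closedBall o r).prod (isCompact_closedBall o r)
  have hunif := tendstoLocallyUniformly_iff_forall_isCompact.1 h _ hcompact
  filter_upwards [Metric.tendstoUniformlyOn_iff.1 hunif η hη] with k hk v hv w hw
  rw [← Real.dist_eq, dist_comm]
  exact (hk (v, w) ⟨hv, hw⟩).le

end DistConverges

theorem exists_subseq_distConverges.{u, v} {E : Type u} [PseudoMetricSpace E] [ProperSpace E]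
    {X : ℕ → Type v} [∀ k, PseudoMetricSpace (X k)] {K : ℝ≥0} {π : ∀ k, E → X k}
    (hπ : ∀ k, LipschitzWith K (π k)) :
    ∃ φ : ℕ → ℕ, StrictMono φ ∧ ∃ (Y : Type u) (_ : MetricSpace Y) (ρ : E → Y),
      Function.Surjective ρ ∧ DistConverges (fun k => π (φ k)) ρ := by
  let f : ℕ → E × E → ℝ := fun k p => dist (π k p.1) (π k p.2)
  have hlip : ∀ k, LipschitzWith (2 * (K * 1)) (f k) := fun k =>
    LipschitzWith.dist.comp (((hπ k).comp LipschitzWith.prod_fst).prodMk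
      ((hπ k).comp LipschitzWith.prod_snd) |>.weaken (by simp))
  have hmem : ∀ k p, f k p ∈ Icc 0 (K * dist p.1 p.2) := fun k p =>
    ⟨dist_nonneg, (hπ k).dist_le_mul _ _⟩
  obtain ⟨φ, hφ, g, hg⟩ := exists_subseq_tendstoLocallyUniformly_of_equicontinuous
    (LipschitzWith.uniformEquicontinuous f _ hlip).equicontinuous
    fun p => ⟨_, isCompact_Icc, fun k => hmem k p⟩
  have hlim : ∀ v w, Tendsto (fun k => f (φ k) (v, w)) atTop (𝓝 (g (v, w))) :=
    fun v w => (tendstoLocallyUniformlyOn_univ.2 hg).tendsto_at (mem_univ (v, w))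
  obtain ⟨Y, _, ρ, hρ, hdist⟩ := exists_metricSpace_quotient (fun v w => g (v, w))
    (fun v => tendsto_nhds_unique (hlim v v) (by simp [f]))
    (fun v w => tendsto_nhds_unique (hlim v w) (by simpa only [f, dist_comm] using hlim w v))
    (fun u v w => le_of_tendsto_of_tendsto' (hlim u w) ((hlim u v).add (hlim v w))
      fun k => dist_triangle _ _ _)
  refine ⟨φ, hφ, Y, inferInstance, ρ, hρ, ?_⟩
  simpa only [DistConverges, hdist] using hg

/-- Approximate intermediate points exist at any pair of distances allowed by the triangle
inequality. For complete spaces this characterizes length spaces, but it is stated by strict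
inequalities so that it survives limits and needs no curves. -/
def AlmostConvex (X : Type*) [PseudoMetricSpace X] : Prop :=
  ∀ ⦃p q : X⦄ ⦃r s : ℝ⦄, 0 < r → 0 < s → dist p q < r + s → ∃ u, dist p u < r ∧ dist u q < s

/-- A `1`-Lipschitz surjection for which distances in `E` are at most affine in those of their
images, with constants `C` and `D`. It is the uniform control of a metric space by a model space `E`
under which sequences of such spaces subconverge. -/
structure IsCoarseQuotientMap {E X : Type*} [PseudoMetricSpace E] [PseudoMetricSpace X]
    (C D : ℝ≥0) (π : E → X) : Prop where
  surjective : Function.Surjective π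
  lipschitzWith : LipschitzWith 1 π
  dist_le : ∀ v w, dist v w ≤ C * dist (π v) (π w) + D

namespace IsCoarseQuotientMap

section

variable {E X Y : Type*} [PseudoMetricSpace E] [PseudoMetricSpace X] [PseudoMetricSpace Y]
  {C D : ℝ≥0} {π : E → X} {ρ : E → Y}

theorem mem_closedBall (h : IsCoarseQuotientMap C D π) {o v : E} {r : ℝ}
    (hv : dist (π v) (π o) ≤ r) : v ∈ Metric.closedBall o (C * r + D) :=
  (h.dist_le v o).trans (by gcongr)

theorem comp_isometryEquiv {E' : Type*} [PseudoMetricSpace E'] (h : IsCoarseQuotientMap C D π)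
    (e : E' ≃ᵢ E) : IsCoarseQuotientMap C D (π ∘ e) where
  surjective := h.surjective.comp e.surjective
  lipschitzWith := by simpa using h.lipschitzWith.comp e.isometry.lipschitz
  dist_le v w := e.dist_eq v w ▸ h.dist_le (e v) (e w)

theorem properSpace [ProperSpace E] (h : IsCoarseQuotientMap C D π) : ProperSpace X := by
  refine ⟨fun p r => ?_⟩
  obtain ⟨o, rfl⟩ := h.surjective p
  refine ((isCompact_closedBall o (C * r + D)).image h.lipschitzWith.continuous).of_isClosed_subset
    Metric.isClosed_closedBall fun q hq => ?_
  obtain ⟨v, rfl⟩ := h.surjective q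
  exact mem_image_of_mem π (h.mem_closedBall hq)

theorem noncompactSpace [ProperSpace E] [NoncompactSpace E] (h : IsCoarseQuotientMap C D π) :
    NoncompactSpace X := by
  refine not_compactSpace_iff.1 fun _ => noncompact_univ E ?_
  refine Metric.isCompact_of_isClosed_isBounded isClosed_univ <| Metric.isBounded_iff.2
    ⟨C * Metric.diam (univ : Set X) + D, fun v _ w _ => (h.dist_le v w).trans ?_⟩
  gcongr
  exact Metric.dist_le_diam_of_mem isCompact_univ.isBounded (mem_univ _) (mem_univ _)

theorem exists_mem_closure_ball (hπ : IsCoarseQuotientMap C D π) (hY : AlmostConvex Y) {o : E}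
    {R η : ℝ} (hR : 0 < R) (hη : 0 < η)
    (hclose : DistCloseOn η (Metric.closedBall o (C * R + D)) π ρ) {a : X}
    (ha : a ∈ closure (Metric.ball (π o) R)) :
    ∃ b ∈ closure (Metric.ball (ρ o) R), ∃ v ∈ Metric.closedBall o (C * R + D),
      π v = a ∧ dist b (ρ v) ≤ 2 * η := by
  obtain ⟨v, rfl⟩ := hπ.surjective a
  have hva : dist (π v) (π o) ≤ R := Metric.closure_ball_subset_closedBall ha
  have hv := hπ.mem_closedBall hva
  have ho : o ∈ Metric.closedBall o (C * R + D) := Metric.mem_closedBall_self (by positivity)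
  have hov : dist (ρ o) (ρ v) < R + 2 * η := by
    linarith [(abs_le.1 (hclose v hv o ho)).1, dist_comm (ρ o) (ρ v)]
  obtain ⟨b, hb, hbv⟩ := hY hR (by positivity) hov
  exact ⟨b, subset_closure (Metric.mem_ball'.2 hb), v, hv, rfl, hbv.le⟩

end

theorem ghEDist_closure_ball_le {E : Type*} {X Y : Type} [PseudoMetricSpace E] [MetricSpace X]
    [MetricSpace Y] {C D : ℝ≥0} {π : E → X} {ρ : E → Y} (hπ : IsCoarseQuotientMap C D π)
    (hρ : IsCoarseQuotientMap C D ρ) (hX : AlmostConvex X) (hY : AlmostConvex Y) {o : E} {R η : ℝ}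
    (hR : 0 < R) (hη : 0 < η)
    (hclose : DistCloseOn η (Metric.closedBall o (C * R + D)) π ρ) :
    ghEDist (closure (Metric.ball (π o) R)) (closure (Metric.ball (ρ o) R)) ≤
      ENNReal.ofReal (5 * η) := by
  have : Nonempty (closure (Metric.ball (π o) R)) :=
    ⟨⟨π o, subset_closure (Metric.mem_ball_self hR)⟩⟩
  refine ghEDist_le_of_biTotal (r := fun a b => ∃ v ∈ Metric.closedBall o (C * R + D),
    dist a.1 (π v) ≤ 2 * η ∧ dist b.1 (ρ v) ≤ 2 * η) ⟨fun a => ?_, fun b => ?_⟩ (by positivity) ?_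
  · obtain ⟨b, hb, v, hv, hva, hvb⟩ := hπ.exists_mem_closure_ball hY hR hη hclose a.2
    exact ⟨⟨b, hb⟩, v, hv, by simp [hva, hη.le], hvb⟩
  · obtain ⟨a, ha, v, hv, hvb, hva⟩ := hρ.exists_mem_closure_ball hX hR hη hclose.symm b.2
    exact ⟨⟨a, ha⟩, v, hv, hva, by simp [hvb, hη.le]⟩
  · rintro a b a' b' ⟨v, hv, hav, hbv⟩ ⟨w, hw, haw, hbw⟩
    have hvw := abs_le.1 (hclose v hv w hw)
    have haa' := abs_le.1 (dist_dist_dist_le a.1 a'.1 (π v) (π w))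
    have hbb' := abs_le.1 (dist_dist_dist_le b.1 b'.1 (ρ v) (ρ w))
    rw [Subtype.dist_eq, Subtype.dist_eq]
    exact abs_le.2 ⟨by linarith, by linarith⟩

theorem of_distConverges {E Y : Type*} {X : ℕ → Type*} [PseudoMetricSpace E]
    [∀ k, PseudoMetricSpace (X k)] [PseudoMetricSpace Y] {C D : ℝ≥0} {π : ∀ k, E → X k} {ρ : E → Y}
    (hπ : ∀ k, IsCoarseQuotientMap C D (π k)) (hρ : Function.Surjective ρ)
    (hlim : DistConverges π ρ) : IsCoarseQuotientMap C D ρ where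
  surjective := hρ
  lipschitzWith := LipschitzWith.of_dist_le_mul fun v w =>
    le_of_tendsto' (hlim.tendsto_dist v w) fun k => (hπ k).lipschitzWith.dist_le_mul v w
  dist_le v w := ge_of_tendsto' (((hlim.tendsto_dist v w).const_mul _).add_const _)
    fun k => (hπ k).dist_le v w

end IsCoarseQuotientMap

theorem AlmostConvex.of_distConverges {E Y : Type*} {X : ℕ → Type*} [PseudoMetricSpace E]
    [ProperSpace E] [∀ k, PseudoMetricSpace (X k)] [PseudoMetricSpace Y] {C D : ℝ≥0}
    {π : ∀ k, E → X k} {ρ : E → Y} (hX : ∀ k, AlmostConvex (X k))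
    (hπ : ∀ k, IsCoarseQuotientMap C D (π k)) (hρ : Function.Surjective ρ)
    (hlim : DistConverges π ρ) : AlmostConvex Y := by
  intro p q r s hr hs hpq
  obtain ⟨v, rfl⟩ := hρ p
  obtain ⟨w, rfl⟩ := hρ q
  have hslack : 0 < (r + s - dist (ρ v) (ρ w)) / 3 := by linarith
  obtain ⟨η, hη, hηmin⟩ := exists_between (lt_min (lt_min hr hs) hslack)
  obtain ⟨⟨hηr, hηs⟩, hηslack⟩ : (η < r ∧ η < s) ∧ η < (r + s - dist (ρ v) (ρ w)) / 3 := by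
    simpa only [lt_min_iff] using hηmin
  set t := max (dist w v) (C * r + D)
  obtain ⟨k, hk⟩ := (hlim.eventually_distCloseOn v t hη).exists
  have hv : v ∈ Metric.closedBall v t :=
    Metric.mem_closedBall_self (dist_nonneg.trans (le_max_left _ _))
  have hw : w ∈ Metric.closedBall v t := Metric.mem_closedBall.2 (le_max_left _ _)
  have hvw := abs_le.1 (hk v hv w hw)
  obtain ⟨u, hvu, huw⟩ := hX k (p := π k v) (q := π k w) (sub_pos.2 hηr) (sub_pos.2 hηs)
    (by linarith)
  obtain ⟨x, rfl⟩ := (hπ k).surjective u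
  have hx : x ∈ Metric.closedBall v t :=
    Metric.closedBall_subset_closedBall (le_max_right _ _)
      ((hπ k).mem_closedBall (by rw [dist_comm]; linarith))
  have hvx := abs_le.1 (hk v hv x hx)
  have hxw := abs_le.1 (hk x hx w hw)
  exact ⟨ρ x, by linarith, by linarith⟩

section Convergence

variable {E : Type*} [PseudoMetricSpace E] [ProperSpace E] {C D : ℝ≥0}

theorem DistConverges.tendsto_ghEDist_closure_ball {X : ℕ → Type} [∀ k, MetricSpace (X k)]
    {Y : Type} [MetricSpace Y] {π : ∀ k, E → X k} {ρ : E → Y} (hlim : DistConverges π ρ)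
    (hX : ∀ k, AlmostConvex (X k)) (hπ : ∀ k, IsCoarseQuotientMap C D (π k))
    (hρ : Function.Surjective ρ) (o : E) {R : ℝ} (hR : 0 < R) :
    Tendsto (fun k => ghEDist (closure (Metric.ball (π k o) R)) (closure (Metric.ball (ρ o) R)))
      atTop (𝓝 0) := by
  have hρ' := IsCoarseQuotientMap.of_distConverges hπ hρ hlim
  have hY := AlmostConvex.of_distConverges hX hπ hρ hlim
  refine ENNReal.tendsto_nhds_zero.2 fun ε hε => ?_
  obtain ⟨x, hx, hxε⟩ := ENNReal.lt_iff_exists_nnreal_btwn.1 hε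
  have hx : (0 : ℝ) < x := ENNReal.coe_pos.1 hx
  have hη : 0 < (x / 5 : ℝ) := by positivity
  filter_upwards [hlim.eventually_distCloseOn o (C * R + D) hη] with k hk
  calc ghEDist (closure (Metric.ball (π k o) R)) (closure (Metric.ball (ρ o) R))
      ≤ ENNReal.ofReal (5 * (x / 5)) :=
        (hπ k).ghEDist_closure_ball_le hρ' (hX k) hY hR hη hk
    _ = x := by rw [mul_div_cancel₀ _ (by norm_num), ENNReal.ofReal_coe_nnreal]
    _ ≤ ε := hxε.le

theorem DistConverges.pghConverges [NoncompactSpace E] {X : ℕ → Type} [∀ k, MetricSpace (X k)]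
    {Y : Type} [MetricSpace Y] {π : ∀ k, E → X k} {ρ : E → Y} (hlim : DistConverges π ρ)
    (hX : ∀ k, AlmostConvex (X k)) (hπ : ∀ k, IsCoarseQuotientMap C D (π k))
    (hρ : Function.Surjective ρ) (o : E) : PGHConverges (fun k => π k o) (ρ o) where
  complete k := have := (hπ k).properSpace; inferInstance
  noncompact k := (hπ k).noncompactSpace
  complete_lim :=
    have := (IsCoarseQuotientMap.of_distConverges hπ hρ hlim).properSpace; inferInstance
  noncompact_lim := (IsCoarseQuotientMap.of_distConverges hπ hρ hlim).noncompactSpace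
  tendsto_ball _ hR := hlim.tendsto_ghEDist_closure_ball hX hπ hρ o hR

end Convergence

theorem pghPrecompact_of_isCoarseQuotientMap {E ι : Type} [PseudoMetricSpace E] [ProperSpace E]
    [NoncompactSpace E] {X : ι → Type} [∀ i, MetricSpace (X i)] {C D : ℝ≥0} {π : ∀ i, E → X i}
    (hX : ∀ i, AlmostConvex (X i)) (hπ : ∀ i, IsCoarseQuotientMap C D (π i)) (o : E) :
    PGHPrecompact fun i => π i o := by
  intro s
  obtain ⟨φ, hφ, Y, _, ρ, hρ, hlim⟩ :=
    exists_subseq_distConverges fun k => (hπ (s k)).lipschitzWith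
  exact ⟨φ, hφ, Y, inferInstance, ρ o, hlim.pghConverges (fun _ => hX _) (fun _ => hπ _) hρ o⟩

namespace Smocking

variable {N : ℕ} (P : Smocking N)

theorem le_dist_of_le_separation {δ : ℝ≥0} (hδ : δ ≤ P.separation) {i j : P.J}
    (hij : i ≠ j) {z z' : EuclideanSpace ℝ (Fin N)} (hz : z ∈ P.stitch i)
    (hz' : z' ∈ P.stitch j) : δ ≤ dist z z' := by
  simp only [separation, le_iInf_iff] at hδ
  have h := hδ i j hij z hz z' hz'
  rw [edist_nndist] at h
  exact_mod_cast h

theorem dist_le_of_lengthMax_le {L : ℝ≥0} (hL : P.lengthMax ≤ L) {j : P.J}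
    {z z' : EuclideanSpace ℝ (Fin N)} (hz : z ∈ P.stitch j) (hz' : z' ∈ P.stitch j) :
    dist z z' ≤ L :=
  edist_le_coe.1 <| (Metric.edist_le_ediam_of_mem hz hz').trans (iSup_le_iff.1 hL j)

theorem dist_le_of_proj_eq {L : ℝ≥0} (hL : P.lengthMax ≤ L) {v w : EuclideanSpace ℝ (Fin N)}
    (hvw : P.proj v = P.proj w) : dist v w ≤ L := by
  cases hw : P.proj w with
  | point x => simp [P.proj_eq_inl (hvw.trans hw), P.proj_eq_inl hw]
  | collapsed j =>
    exact P.dist_le_of_lengthMax_le hL (P.proj_eq_inr (hvw.trans hw)) (P.proj_eq_inr hw)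

theorem dist_proj_le (v w : EuclideanSpace ℝ (Fin N)) :
    dist (P.proj v) (P.proj w) ≤ dist v w :=
  csInf_le (P.bddBelow_connectingLengths _ _) (P.dist_mem_connectingLengths v w)

/-- A list of triples `(j, z, z')` is a route if each of them crosses a stitch: it enters `I_j` at
`z` and leaves it at `z'`. Unlike in `chainLengths`, successive stitches may coincide, so that
routes can be cut and extended freely. -/
def IsRoute (l : List (P.J × EuclideanSpace ℝ (Fin N) × EuclideanSpace ℝ (Fin N))) : Prop :=
  ∀ a ∈ l, a.2.1 ∈ P.stitch a.1 ∧ a.2.2 ∈ P.stitch a.1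

variable {P} {l : List (P.J × EuclideanSpace ℝ (Fin N) × EuclideanSpace ℝ (Fin N))}

theorem isRoute_cons {a : P.J × EuclideanSpace ℝ (Fin N) × EuclideanSpace ℝ (Fin N)} :
    P.IsRoute (a :: l) ↔ (a.2.1 ∈ P.stitch a.1 ∧ a.2.2 ∈ P.stitch a.1) ∧ P.IsRoute l :=
  List.forall_mem_cons

namespace IsRoute

theorem dist_proj_le_pathLength (hl : P.IsRoute l) (v w : EuclideanSpace ℝ (Fin N)) :
    dist (P.proj v) (P.proj w) ≤ P.pathLength v l w := by
  obtain ⟨m, hm, hchain, hle⟩ := P.exists_reduced w l hl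
  exact (csInf_le (P.bddBelow_connectingLengths _ _)
    ⟨v, w, rfl, rfl, _, m, rfl, hm, hchain, rfl⟩).trans (hle v)

theorem dist_le_pathLength_add (hl : P.IsRoute l) {L : ℝ≥0} (hL : P.lengthMax ≤ L)
    (v w : EuclideanSpace ℝ (Fin N)) : dist v w ≤ P.pathLength v l w + l.length * L := by
  induction l generalizing v with
  | nil => simp [pathLength]
  | cons a l ih =>
    obtain ⟨⟨hz, hz'⟩, hl⟩ := isRoute_cons.1 hl
    have hstitch := P.dist_le_of_lengthMax_le hL hz hz'
    have htail := ih hl a.2.2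
    simp only [pathLength, List.length_cons, Nat.cast_succ]
    linarith [dist_triangle4 v a.2.1 a.2.2 w]

theorem length_mul_le_pathLength_add (hl : P.IsRoute l) (hchain : l.IsChain fun a b => a.1 ≠ b.1)
    {δ : ℝ≥0} (hδ : δ ≤ P.separation) (v w : EuclideanSpace ℝ (Fin N)) :
    l.length * δ ≤ P.pathLength v l w + δ := by
  induction l generalizing v with
  | nil => simpa using add_nonneg (P.pathLength_nonneg v w []) δ.2
  | cons a l ih =>
    cases l with
    | nil => simpa using P.pathLength_nonneg v w [a]
    | cons b l =>
      obtain ⟨hab, hchain⟩ := List.isChain_cons_cons.1 hchain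
      obtain ⟨⟨-, ha⟩, hl⟩ := isRoute_cons.1 hl
      have hgap := P.le_dist_of_le_separation hδ hab ha (isRoute_cons.1 hl).1.1
      -- starting the tail at the entry point of `b` leaves the gap from `a` to `b` to be counted
      have htail := ih hl hchain b.2.1
      simp only [pathLength, List.length_cons, dist_self, Nat.cast_succ] at htail ⊢
      linarith [dist_nonneg (x := v) (y := a.2.1)]

theorem exists_between (hl : P.IsRoute l) {v w : EuclideanSpace ℝ (Fin N)} {r s : ℝ} (hr : 0 < r)
    (hs : 0 < s) (h : P.pathLength v l w < r + s) :
    ∃ u, dist (P.proj v) u < r ∧ dist u (P.proj w) < s := by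
  induction l generalizing v r with
  | nil =>
    obtain ⟨u, hvu, huw⟩ := exists_dist_lt_lt hr hs (add_comm r s ▸ h)
    exact ⟨P.proj u, (P.dist_proj_le v u).trans_lt hvu, (P.dist_proj_le u w).trans_lt huw⟩
  | cons a l ih =>
    obtain ⟨⟨hz, hz'⟩, hl'⟩ := isRoute_cons.1 hl
    simp only [pathLength] at h
    rcases lt_or_ge (dist v a.2.1) r with hva | hva
    · obtain ⟨u, hau, huw⟩ := ih hl' (v := a.2.2) (sub_pos.2 hva) (by linarith)
      rw [P.proj_of_mem hz', ← P.proj_of_mem hz] at hau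
      exact ⟨u, by linarith [dist_triangle (P.proj v) (P.proj a.2.1) u, P.dist_proj_le v a.2.1],
        huw⟩
    · obtain ⟨u, hvu, hua⟩ := exists_dist_lt_lt (x := v) (z := a.2.1)
        (ε := s - P.pathLength a.2.2 l w) hr (by linarith) (by linarith)
      refine ⟨P.proj u, (P.dist_proj_le v u).trans_lt hvu,
        (hl.dist_proj_le_pathLength u w).trans_lt ?_⟩
      simpa only [pathLength] using lt_sub_iff_add_lt.1 hua

end IsRoute

theorem almostConvex_space (P : Smocking N) : AlmostConvex P.Space := by
  intro p q r s hr hs hpq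
  obtain ⟨_, ⟨v, w, rfl, rfl, -, l, -, hl, -, rfl⟩, hlt⟩ :=
    exists_lt_of_csInf_lt (P.connectingLengths_nonempty p q) hpq
  exact IsRoute.exists_between hl hr hs hlt

theorem dist_le_of_mem_connectingLengths {L δ : ℝ≥0} (hδ : 0 < δ) (hL : P.lengthMax ≤ L)
    (hsep : δ ≤ P.separation) {v w : EuclideanSpace ℝ (Fin N)} {ℓ : ℝ}
    (hℓ : ℓ ∈ P.connectingLengths (P.proj v) (P.proj w)) :
    dist v w ≤ (1 + L / δ) * ℓ + 3 * L := by
  obtain ⟨v', w', hv, hw, -, l, -, hl, hchain, rfl⟩ := hℓ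
  have hδ₀ : (δ : ℝ) ≠ 0 := (NNReal.coe_pos.2 hδ).ne'
  have hlength := IsRoute.length_mul_le_pathLength_add hl hchain hsep v' w'
  have hstitches : l.length * (L : ℝ) ≤ L / δ * P.pathLength v' l w' + L := by
    calc l.length * (L : ℝ) = L / δ * (l.length * δ) := by field_simp
      _ ≤ L / δ * (P.pathLength v' l w' + δ) := by gcongr
      _ = L / δ * P.pathLength v' l w' + L := by field_simp
  calc dist v w ≤ dist v v' + dist v' w' + dist w' w := dist_triangle4 v v' w' w
    _ ≤ L + (P.pathLength v' l w' + l.length * L) + L := by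
      gcongr
      · exact P.dist_le_of_proj_eq hL hv.symm
      · exact IsRoute.dist_le_pathLength_add hl hL v' w'
      · exact P.dist_le_of_proj_eq hL hw
    _ ≤ (1 + L / δ) * P.pathLength v' l w' + 3 * L := by linarith

theorem isCoarseQuotientMap_proj {L δ : ℝ≥0} (hδ : 0 < δ) (hL : P.lengthMax ≤ L)
    (hsep : δ ≤ P.separation) : IsCoarseQuotientMap (1 + L / δ) (3 * L) P.proj where
  surjective := P.proj_surjective
  lipschitzWith := LipschitzWith.of_dist_le_mul fun v w => by simpa using P.dist_proj_le v w
  dist_le v w := by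
    have hC : (0 : ℝ) < 1 + L / δ := by positivity
    have h : (dist v w - 3 * L) / (1 + L / δ) ≤ dist (P.proj v) (P.proj w) :=
      le_csInf (P.connectingLengths_nonempty _ _) fun ℓ hℓ => by
        rw [div_le_iff₀' hC]
        linarith [dist_le_of_mem_connectingLengths hδ hL hsep hℓ]
    rw [div_le_iff₀' hC] at h
    push_cast
    linarith

theorem dim_ne_zero (hdepth : P.depth ≠ ∞) (hlength : 0 < P.lengthMin) : N ≠ 0 := by
  rintro rfl
  obtain ⟨r, hr, -⟩ := sInf_lt_iff.1 (lt_top_iff_ne_top.2 hdepth)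
  obtain ⟨j, -⟩ := hr 0
  have hj : Metric.ediam (P.stitch j) = 0 := Metric.ediam_subsingleton subsingleton_of_subsingleton
  exact hlength.not_ge (hj ▸ iInf_le _ j)

end Smocking

theorem proposition3p5_general {N : ℕ} (hN : N ≠ 0) {ι : Type} (P : ι → Smocking N) {L δ : ℝ≥0}
    (hδ : 0 < δ) (hL : ∀ i, (P i).lengthMax ≤ L) (hsep : ∀ i, δ ≤ (P i).separation)
    (x : ∀ i, (P i).Space) : PGHPrecompact x := by
  choose o ho using fun i => (P i).proj_surjective (x i)
  obtain rfl : (fun i => (P i).proj (o i)) = x := funext ho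
  have : NeZero N := ⟨hN⟩
  have : NoncompactSpace (EuclideanSpace ℝ (Fin N)) := NormedSpace.noncompactSpace ℝ _
  -- translating `o i` to `0` makes all the base points the image of one point
  simpa using pghPrecompact_of_isCoarseQuotientMap (fun i => (P i).almostConvex_space)
    (fun i => (Smocking.isCoarseQuotientMap_proj hδ (hL i) (hsep i)).comp_isometryEquiv
      (IsometryEquiv.addRight (o i))) 0

theorem proposition3p5 (N : ℕ) (P : ℕ → Smocking N) (Lmax h δ Lmin : ℝ≥0)
    (hδ : 0 < δ) (hLmin : 0 < Lmin)
    (hLmax_le : ∀ k, (P k).lengthMax ≤ (Lmax : ℝ≥0∞))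
    (hdepth_le : ∀ k, (P k).depth ≤ (h : ℝ≥0∞))
    (hδ_le : ∀ k, (δ : ℝ≥0∞) ≤ (P k).separation)
    (hLmin_le : ∀ k, (Lmin : ℝ≥0∞) ≤ (P k).lengthMin) :
    PGHPrecompact (fun k => (P k).proj 0) :=
  have hN : N ≠ 0 :=
    Smocking.dim_ne_zero (ne_top_of_le_ne_top ENNReal.coe_ne_top (hdepth_le 0))
      ((ENNReal.coe_pos.2 hLmin).trans_le (hLmin_le 0))
  proposition3p5_general hN P hδ hLmax_le hδ_le fun k => (P k).proj 0
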